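/- **Model.** Two users share a broadcast channel. User $i\in\{1,2\}$ has a buffer holding $X^i_t\in\{0,1\}$ packets at time $t\in\{1,2,\dots\}$. Let $p^1,p^2\in(0,1)$. The initial states $X^i_1$ and the arrivals $W^i_t\in\{0,1\}$ are mutually independent with $\mathbb P(X^i_1=1)=\mathbb P(W^i_t=1)=p^i$. User $i$ transmits $U^i_t=g^i_t(X^i_t,\mathbf U_{1:t-1})\in\{0,1\}$, where $\mathbf U_t=(U^1_t,U^2_t)$ and $U^i_t\le X^i_t$ (feasibility), and $$X^i_{t+1}=\min(X^i_t-U^i_t+U^1_tU^2_t+W^i_t,\,1).$$ The cost $\ell(\mathbf u)$ of a joint decision is $\ell(0,0)=0$, $\ell(1,0)=\ell^1\le 0$, $\ell(0,1)=\ell^2\le 0$, $\ell(1,1)=\ell^3\in\mathbb R$. For $\beta\in(0,1)$ put $J(\mathbf g)=\mathbb E^{\mathbf g}\big[\sum_{t\ge1}\beta^{t-1}\ell(\mathbf U_t)\big]$. A feasible strategy is determined by the actions $\mathbf a_t=(g^1_t(1,\mathbf U_{1:t-1}),g^2_t(1,\mathbf U_{1:t-1}))\in\{0,1\}^2$ that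 it prescribes, since $U^i_t=a^i_tX^i_t$. Let $\mathcal A=\{(0,1),(1,0),(1,1)\}$. **Information state.** Let $T_iq=1-(1-p^i)(1-q)$, and for $\pi=(\pi^1,\pi^2)$, $\mathbf a\in\mathcal A$, $\mathbf u\in\{0,1\}^2$ let $\phi(\pi,\mathbf a,\mathbf u)$ be $(p^1,T_2\pi^2)$ if $\mathbf a=(1,0)$; $(T_1\pi^1,p^2)$ if $\mathbf a=(0,1)$; $(1,1)$ if $\mathbf a=\mathbf u=(1,1)$; and $(p^1,p^2)$ if $\mathbf a=(1,1)\ne\mathbf u$. The reachable set from $(p^1,p^2)$ is $$\mathcal R=\{(1,1),(1,p^2),(p^1,1),(p^1,p^2)\}\cup\{(p^1,T_2^np^2):n\in\mathbb N\}\cup\{(T_1^np^1,p^2):n\in\mathbb N\}.$$ Let $\hat\ell(\pi,(1,0))=\ell^1\pi^1$, $\hat\ell(\pi,(0,1))=\ell^2\pi^2$, $\hat\ell(\pi,(1,1))=\ell^1\pi^1+\ell^2\pi^2+(\ell^3-\ell^1-\ell^2)\pi^1\pi^2$. **Theorem.** The dynamic program $$V(\pi)=\min_{\mathbf a\in\mathcal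 A}\Big(\hat\ell(\pi,\mathbf a)+\beta\,\mathbb E\big[V(\phi(\pi,\mathbf a,\mathbf U))\big]\Big),\qquad \pi\in\mathcal R,$$ where $\mathbf U=(a^1X^1,a^2X^2)$ with $X^1,X^2$ independent Bernoulli variables of parameters $\pi^1,\pi^2$, has exactly one bounded solution $V$ on $\mathcal R$. Let $\psi^*(\pi)\in\mathcal A$ be any argmin of its right-hand side for this $V$, for every $\pi\in\mathcal R$. Let $\mathbf g^*$ be the strategy under which user $i$ transmits $$g^{i,*}(\pi_t,x)=\psi^{i,*}(\pi_t)\cdot x,\qquad x\in\{0,1\},\ i=1,2,$$ where $\pi_1=(p^1,p^2)$ and $\pi_{t+1}=\phi(\pi_t,\psi^*(\pi_t),\mathbf U_t)$. Then $\pi_t\in\mathcal R$ always, and under $\mathbf g^*$ one has $\pi^i_t=\mathbb P(X^i_t=1\mid\mathbf U_{1:t-1})$ almost surely. Moreover $\mathbf g^*$ is optimal, in the following sense: 1. $J(\mathbf g^*)\le J(\mathbf g)$ for every feasible strategy $\mathbf g$ whose prescribed actions all lie in $\mathcal A$; 2. if $\ell^3\ge 0$ (collisions are not rewarded), then $J(\mathbf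 g^*)\le J(\mathbf g)$ for every feasible strategy $\mathbf g$. -/

import Mathlib

open MeasureTheory ProbabilityTheory

noncomputable section

namespace MABC

/-! Users `1, 2` are indexed by `0, 1 : Fin 2`; bits `0, 1` are `false, true : Bool`.
Time is counted from `0`, so that step `t` here is time `t + 1` of the usual numbering. -/

/-- One bit for each of the two users: a pair of buffer states, of transmission decisions,
of arrivals, or an action of the coordinator. -/
abbrev Bits := Fin 2 → Bool

/-- The buffer update `X ↦ min (X - U + U¹ U² + W, 1)` of both users, as a bit
(`min (k, 1) = 1` iff `1 ≤ k`). -/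
def nextState (x u w : Bits) : Bits := fun i =>
  decide (1 ≤ (x i).toNat - (u i).toNat + (u 0).toNat * (u 1).toNat + (w i).toNat)

/-- The per-step cost as a function of the two transmission decisions. -/
def stageCost (l1 l2 l3 : ℝ) (u : Bits) : ℝ :=
  match u 0, u 1 with
  | false, false => 0
  | true, false => l1
  | false, true => l2
  | true, true => l3

/-- A joint decentralized strategy. `g i h x` is the decision of user `i` when the past joint
decisions are `h` (the most recent one first) and its own buffer state is `x`. The time is
determined by the length of `h`, so time-varying control laws are included. -/
abbrev Strategy := Fin 2 → List Bits → Bool → Bool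

/-- A user with an empty buffer cannot transmit. -/
def Feasible (g : Strategy) : Prop := ∀ i h, g i h false = false

/-- Buffer states and history of joint decisions at each time, under the strategy `g`, when the
initial buffer states are `x₁` and the arrivals are `w`. -/
def trajectory (g : Strategy) (x₁ : Bits) (w : ℕ → Bits) : ℕ → Bits × List Bits
  | 0 => (x₁, [])
  | t + 1 =>
    let s := trajectory g x₁ w t
    let u : Bits := fun i => g i s.2 (s.1 i)
    (nextState s.1 u (w t), u :: s.2)

section Dynamics

variable {Ω : Type*}

/-- The buffer states `X_t` under the strategy `g`. -/
def bufferState (X₁ : Fin 2 → Ω → Bool) (W : ℕ → Fin 2 → Ω → Bool) (g : Strategy)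
    (t : ℕ) (ω : Ω) : Bits :=
  (trajectory g (fun i => X₁ i ω) (fun s i => W s i ω) t).1

/-- The common information (all joint decisions before time `t`) under the strategy `g`. -/
def history (X₁ : Fin 2 → Ω → Bool) (W : ℕ → Fin 2 → Ω → Bool) (g : Strategy)
    (t : ℕ) (ω : Ω) : List Bits :=
  (trajectory g (fun i => X₁ i ω) (fun s i => W s i ω) t).2

/-- The joint decision `U_t` under the strategy `g`. -/
def decision (X₁ : Fin 2 → Ω → Bool) (W : ℕ → Fin 2 → Ω → Bool) (g : Strategy)
    (t : ℕ) (ω : Ω) : Bits :=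
  fun i => g i (history X₁ W g t ω) (bufferState X₁ W g t ω i)

variable [MeasurableSpace Ω]

/-- The law of the primitive random variables: all initial buffer states and arrivals are mutually
independent, and those of user `i` are Bernoulli with parameter `p i`. -/
structure PrimitiveLaw (P : Measure Ω) (p : Fin 2 → ℝ)
    (X₁ : Fin 2 → Ω → Bool) (W : ℕ → Fin 2 → Ω → Bool) : Prop where
  measurable_init : ∀ i, Measurable (X₁ i)
  measurable_arrival : ∀ t i, Measurable (W t i)
  prob_init : ∀ i, P.real {ω | X₁ i ω = true} = p i
  prob_arrival : ∀ t i, P.real {ω | W t i ω = true} = p i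
  indep : iIndepFun (Sum.elim X₁ (fun q : ℕ × Fin 2 => W q.1 q.2)) P

/-- The expected total discounted cost of the strategy `g`. -/
def totalCost (P : Measure Ω) (X₁ : Fin 2 → Ω → Bool) (W : ℕ → Fin 2 → Ω → Bool)
    (β l1 l2 l3 : ℝ) (g : Strategy) : ℝ :=
  ∫ ω, ∑' t : ℕ, β ^ t * stageCost l1 l2 l3 (decision X₁ W g t ω) ∂P

end Dynamics

/-- `g` belongs to the class `S` of strategies and no member of `S` has a smaller cost. -/
def IsOptimalIn (J : Strategy → ℝ) (S : Set Strategy) (g : Strategy) : Prop :=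
  g ∈ S ∧ ∀ g' ∈ S, J g ≤ J g'

/-- The action space `{(0,1), (1,0), (1,1)}` of the coordinator. -/
def actions : Set Bits := {![false, true], ![true, false], ![true, true]}

/-- The action that the strategy `g` prescribes after the history `h`: the pair of decisions
of users whose buffers are full. A feasible strategy is determined by these actions, since then
`g i h x = prescribed g h i · x`. -/
def prescribed (g : Strategy) (h : List Bits) : Bits := fun i => g i h true

/-- The decisions `a · x` caused by the action `a` in the buffer states `x`. -/
def transmit (a x : Bits) : Bits := fun i => a i && x i

/-- The operator `T q = 1 - (1 - r) (1 - q)`: the probability that a buffer is full after one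
step without transmission, for arrival rate `r` and probability `q` that it was full. -/
def opT (r q : ℝ) : ℝ := 1 - (1 - r) * (1 - q)

/-- The update of the information state for action `a` and observed decisions `u`. -/
def update (p π : Fin 2 → ℝ) (a u : Bits) : Fin 2 → ℝ :=
  match a 0, a 1 with
  | false, false => ![opT (p 0) (π 0), opT (p 1) (π 1)]
  | true, false => ![p 0, opT (p 1) (π 1)]
  | false, true => ![opT (p 0) (π 0), p 1]
  | true, true => if u 0 = true ∧ u 1 = true then ![1, 1] else ![p 0, p 1]

/-- The expected per-step cost in the information state `π` for the action `a`. -/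
def expectedCost (l1 l2 l3 : ℝ) (π : Fin 2 → ℝ) (a : Bits) : ℝ :=
  match a 0, a 1 with
  | false, false => 0
  | true, false => l1 * π 0
  | false, true => l2 * π 1
  | true, true => l1 * π 0 + l2 * π 1 + (l3 - l1 - l2) * (π 0 * π 1)

/-- The probability of the buffer states `x` in the information state `π`. -/
def stateProb (π : Fin 2 → ℝ) (x : Bits) : ℝ := ∏ i, if x i = true then π i else 1 - π i

/-- The expectation of `V` at the next information state, given the information state `π` and the
action `a`; the observed decisions are `transmit a x`, where `x` has law `stateProb π`. -/
def expectedNext (p : Fin 2 → ℝ) (V : (Fin 2 → ℝ) → ℝ) (π : Fin 2 → ℝ) (a : Bits) : ℝ :=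
  ∑ x : Bits, stateProb π x * V (update p π a (transmit a x))

/-- The function minimized on the right-hand side of the dynamic program. -/
def bellmanRHS (p : Fin 2 → ℝ) (β l1 l2 l3 : ℝ) (V : (Fin 2 → ℝ) → ℝ) (π : Fin 2 → ℝ)
    (a : Bits) : ℝ :=
  expectedCost l1 l2 l3 π a + β * expectedNext p V π a

/-- The reachable set of information states, where the initial one is `p`. -/
def reachableSet (p : Fin 2 → ℝ) : Set (Fin 2 → ℝ) :=
  {![1, 1], ![1, p 1], ![p 0, 1], ![p 0, p 1]} ∪
    {π | ∃ n : ℕ, π = ![p 0, (opT (p 1))^[n] (p 1)]} ∪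
    {π | ∃ n : ℕ, π = ![(opT (p 0))^[n] (p 0), p 1]}

/-- `V` is a bounded solution of the dynamic program on the reachable set. -/
def SolvesDP (p : Fin 2 → ℝ) (β l1 l2 l3 : ℝ) (V : (Fin 2 → ℝ) → ℝ) : Prop :=
  (∃ C : ℝ, ∀ π ∈ reachableSet p, |V π| ≤ C) ∧
    ∀ π ∈ reachableSet p, IsLeast (bellmanRHS p β l1 l2 l3 V π '' actions) (V π)

/-- `ψ` selects at every reachable information state a minimizing action of the
right-hand side of the dynamic program. -/
def IsArgmin (p : Fin 2 → ℝ) (β l1 l2 l3 : ℝ) (V : (Fin 2 → ℝ) → ℝ)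
    (ψ : (Fin 2 → ℝ) → Bits) : Prop :=
  ∀ π ∈ reachableSet p, ψ π ∈ actions ∧
    ∀ a ∈ actions, bellmanRHS p β l1 l2 l3 V π (ψ π) ≤ bellmanRHS p β l1 l2 l3 V π a

/-- The information state that both users compute from the common information `h`
(most recent joint decision first) when the coordinator uses the stationary law `ψ`. -/
def infoState (p : Fin 2 → ℝ) (ψ : (Fin 2 → ℝ) → Bits) : List Bits → (Fin 2 → ℝ)
  | [] => p
  | u :: h => update p (infoState p ψ h) (ψ (infoState p ψ h)) u

/-- The decentralized strategy that is stationary in the information state: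
user `i` transmits `ψⁱ(π) · x`. -/
def stationaryStrategy (p : Fin 2 → ℝ) (ψ : (Fin 2 → ℝ) → Bits) : Strategy :=
  fun i h x => ψ (infoState p ψ h) i && x

end MABC

end

open MABC

open MeasureTheory ProbabilityTheory
noncomputable section
namespace MABC

/-! Given the common information, the two buffers are independent, with parameters given by an
information state computed from past actions and decisions (`step_stateProb`,
`PrimitiveLaw.measureReal_stateEvent`). A feasible strategy is therefore a control of this state,
and its expected stage cost plus the discounted expected value of the next state is an average of
`bellmanRHS` (`PrimitiveLaw.integral_cost_add`). Telescoping bounds its total cost below by `V p`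
whenever `V` is at most `bellmanRHS` along the strategy, and above under the reverse inequality.

The dynamic program is a `β`-contraction on any set of information states stable under the three
actions. A general strategy may also idle, and its information state can then leave the reachable
set, so the comparison uses a solution on the whole box `[0,1]²`. By uniqueness it agrees with the
given `V` on the reachable set, where an argmin of `V` attains it.

It remains to show that idling never beats the other actions when `l3 ≥ 0` (`SolvesOn.le_idle`). If
one user transmits alone after the idle slot, let it transmit now as well. If both transmit after
it, let the first user transmit now and then both. The second comparison needs the discounted
advantage of two full buffers over fresh ones to be at most the reward `-(l1 + l2)` of two
successful transmissions (`SolvesOn.gap_nonpos`). -/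

/-! ### Information states and stability of the reachable set -/

/-- The set of all pairs of probabilities. -/
def box : Set (Fin 2 → ℝ) := {π | ∀ i, π i ∈ Set.Icc (0 : ℝ) 1}

lemma mk_mem_box {x y : ℝ} (hx : x ∈ Set.Icc (0 : ℝ) 1) (hy : y ∈ Set.Icc (0 : ℝ) 1) :
    ![x, y] ∈ box := by
  intro i
  fin_cases i
  · exact hx
  · exact hy

lemma one_mem_Icc : (1 : ℝ) ∈ Set.Icc (0 : ℝ) 1 := by simp

lemma opT_mem_Icc {r q : ℝ} (hr : r ∈ Set.Icc (0 : ℝ) 1) (hq : q ∈ Set.Icc (0 : ℝ) 1) :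
    opT r q ∈ Set.Icc (0 : ℝ) 1 := by
  obtain ⟨h1, h2⟩ := hr
  obtain ⟨h3, h4⟩ := hq
  unfold opT
  constructor <;> nlinarith [mul_nonneg (sub_nonneg.2 h2) (sub_nonneg.2 h4)]

lemma opT_one (r : ℝ) : opT r 1 = 1 := by simp [opT]

lemma eta_two (π : Fin 2 → ℝ) : ![π 0, π 1] = π := by
  ext i
  fin_cases i <;> rfl

lemma opT_iterate_mem_Icc {r : ℝ} (hr : r ∈ Set.Icc (0 : ℝ) 1) (n : ℕ) :
    (opT r)^[n] r ∈ Set.Icc (0 : ℝ) 1 := by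
  induction n with
  | zero => exact hr
  | succ n ih => rw [Function.iterate_succ_apply']; exact opT_mem_Icc hr ih

lemma update_mem_box {p π : Fin 2 → ℝ} (hp : p ∈ box) (hπ : π ∈ box) (a u : Bits) :
    update p π a u ∈ box := by
  unfold update
  split
  · exact mk_mem_box (opT_mem_Icc (hp 0) (hπ 0)) (opT_mem_Icc (hp 1) (hπ 1))
  · exact mk_mem_box (hp 0) (opT_mem_Icc (hp 1) (hπ 1))
  · exact mk_mem_box (opT_mem_Icc (hp 0) (hπ 0)) (hp 1)
  · split
    · exact mk_mem_box one_mem_Icc one_mem_Icc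
    · exact mk_mem_box (hp 0) (hp 1)

lemma reachableSet_subset_box {p : Fin 2 → ℝ} (hp : p ∈ box) : reachableSet p ⊆ box := by
  rintro π ((h | ⟨n, rfl⟩) | ⟨n, rfl⟩)
  · rcases h with rfl | rfl | rfl | rfl
    · exact mk_mem_box one_mem_Icc one_mem_Icc
    · exact mk_mem_box one_mem_Icc (hp 1)
    · exact mk_mem_box (hp 0) one_mem_Icc
    · exact mk_mem_box (hp 0) (hp 1)
  · exact mk_mem_box (hp 0) (opT_iterate_mem_Icc (hp 1) n)
  · exact mk_mem_box (opT_iterate_mem_Icc (hp 0) n) (hp 1)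

lemma initial_mem_reachableSet (p : Fin 2 → ℝ) : p ∈ reachableSet p :=
  Or.inl (Or.inl (by simp [eta_two]))

lemma left_mem_reachableSet {p : Fin 2 → ℝ} {y : ℝ} (hy : y = 1 ∨ ∃ n, y = (opT (p 1))^[n] (p 1)) :
    ![p 0, y] ∈ reachableSet p := by
  rcases hy with rfl | ⟨n, rfl⟩
  · exact Or.inl (Or.inl (by simp))
  · exact Or.inl (Or.inr ⟨n, rfl⟩)

lemma right_mem_reachableSet {p : Fin 2 → ℝ} {x : ℝ} (hx : x = 1 ∨ ∃ n, x = (opT (p 0))^[n] (p 0)) :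
    ![x, p 1] ∈ reachableSet p := by
  rcases hx with rfl | ⟨n, rfl⟩
  · exact Or.inl (Or.inl (by simp))
  · exact Or.inr ⟨n, rfl⟩

lemma coord_of_mem_reachableSet {p π : Fin 2 → ℝ} (hπ : π ∈ reachableSet p) (i : Fin 2) :
    π i = 1 ∨ ∃ n, π i = (opT (p i))^[n] (p i) := by
  have h0 (j : Fin 2) : ∃ n, p j = (opT (p j))^[n] (p j) := ⟨0, rfl⟩
  rcases hπ with (h | ⟨n, rfl⟩) | ⟨n, rfl⟩
  · rcases h with rfl | rfl | rfl | rfl <;> fin_cases i <;> simp [h0]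
  · fin_cases i
    · exact Or.inr (h0 0)
    · exact Or.inr ⟨n, rfl⟩
  · fin_cases i
    · exact Or.inr ⟨n, rfl⟩
    · exact Or.inr (h0 1)

lemma opT_coord {r q : ℝ} (h : q = 1 ∨ ∃ n, q = (opT r)^[n] r) :
    opT r q = 1 ∨ ∃ n, opT r q = (opT r)^[n] r := by
  rcases h with rfl | ⟨n, rfl⟩
  · exact Or.inl (opT_one r)
  · exact Or.inr ⟨n + 1, (Function.iterate_succ_apply' _ _ _).symm⟩

/-- A lone transmission resets one coordinate to its arrival rate and applies `opT` to the other, so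
only the orbit of the other coordinate matters. When both users are told to transmit, the next state
is `(1, 1)` or `p`. -/
lemma update_mem_reachableSet {p π : Fin 2 → ℝ} (hπ : π ∈ reachableSet p) {a : Bits}
    (ha : a ∈ actions) (u : Bits) : update p π a u ∈ reachableSet p := by
  rcases ha with rfl | rfl | rfl
  · exact right_mem_reachableSet (opT_coord (coord_of_mem_reachableSet hπ 0))
  · exact left_mem_reachableSet (opT_coord (coord_of_mem_reachableSet hπ 1))
  · change (if u 0 = true ∧ u 1 = true then ![1, 1] else ![p 0, p 1]) ∈ _
    split
    · exact Or.inl (Or.inl (by simp))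
    · rw [eta_two]; exact initial_mem_reachableSet p

/-! ### One-step expectations and their Lipschitz bounds -/

lemma sum_bits (f : Bits → ℝ) :
    ∑ x, f x = f ![false, false] + f ![false, true] + f ![true, false] + f ![true, true] := by
  rw [← (finTwoArrowEquiv Bool).symm.sum_comp, Fintype.sum_prod_type]
  simp only [Fintype.sum_bool, finTwoArrowEquiv_symm_apply]
  ring

lemma bits_cases (a : Bits) :
    a = ![false, false] ∨ a = ![false, true] ∨ a = ![true, false] ∨ a = ![true, true] := by
  have h : a = ![a 0, a 1] := by
    ext i
    fin_cases i <;> rfl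
  rw [h]
  cases a 0 <;> cases a 1 <;> simp

lemma stateProb_nonneg {π : Fin 2 → ℝ} (hπ : π ∈ box) (x : Bits) : 0 ≤ stateProb π x := by
  refine Finset.prod_nonneg fun i _ => ?_
  split
  · exact (hπ i).1
  · exact sub_nonneg.2 (hπ i).2

lemma sum_stateProb (π : Fin 2 → ℝ) : ∑ x, stateProb π x = 1 := by
  simp [sum_bits, stateProb, Fin.prod_univ_two]
  ring

lemma expectedNext_idle (p : Fin 2 → ℝ) (V : (Fin 2 → ℝ) → ℝ) (π : Fin 2 → ℝ) :
    expectedNext p V π ![false, false] = V ![opT (p 0) (π 0), opT (p 1) (π 1)] := by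
  have h (u : Bits) :
      update p π ![false, false] u = ![opT (p 0) (π 0), opT (p 1) (π 1)] := rfl
  simp only [expectedNext, h, ← Finset.sum_mul, sum_stateProb, one_mul]

lemma expectedNext_fst (p : Fin 2 → ℝ) (V : (Fin 2 → ℝ) → ℝ) (π : Fin 2 → ℝ) :
    expectedNext p V π ![true, false] = V ![p 0, opT (p 1) (π 1)] := by
  have h (u : Bits) : update p π ![true, false] u = ![p 0, opT (p 1) (π 1)] := rfl
  simp only [expectedNext, h, ← Finset.sum_mul, sum_stateProb, one_mul]

lemma expectedNext_snd (p : Fin 2 → ℝ) (V : (Fin 2 → ℝ) → ℝ) (π : Fin 2 → ℝ) :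
    expectedNext p V π ![false, true] = V ![opT (p 0) (π 0), p 1] := by
  have h (u : Bits) : update p π ![false, true] u = ![opT (p 0) (π 0), p 1] := rfl
  simp only [expectedNext, h, ← Finset.sum_mul, sum_stateProb, one_mul]

/-- A collision has probability `π 0 * π 1`; every other outcome empties both buffers before the
arrivals. -/
lemma expectedNext_both (p : Fin 2 → ℝ) (V : (Fin 2 → ℝ) → ℝ) (π : Fin 2 → ℝ) :
    expectedNext p V π ![true, true] = π 0 * π 1 * V ![1, 1] + (1 - π 0 * π 1) * V p := by
  simp [expectedNext, sum_bits, stateProb, Fin.prod_univ_two, update, transmit, eta_two]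
  ring

lemma expectedNext_sub_le {p π : Fin 2 → ℝ} (hπ : π ∈ box) {V V' : (Fin 2 → ℝ) → ℝ} {a : Bits}
    {C : ℝ} (h : ∀ u, |V (update p π a u) - V' (update p π a u)| ≤ C) :
    |expectedNext p V π a - expectedNext p V' π a| ≤ C := by
  unfold expectedNext
  rw [← Finset.sum_sub_distrib]
  calc _ ≤ ∑ x, |stateProb π x * V (update p π a (transmit a x)) -
          stateProb π x * V' (update p π a (transmit a x))| := Finset.abs_sum_le_sum_abs _ _
    _ ≤ ∑ x, stateProb π x * C := by
        refine Finset.sum_le_sum fun x _ => ?_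
        rw [← mul_sub, abs_mul, abs_of_nonneg (stateProb_nonneg hπ x)]
        exact mul_le_mul_of_nonneg_left (h _) (stateProb_nonneg hπ x)
    _ = C := by rw [← Finset.sum_mul, sum_stateProb, one_mul]

lemma bellmanRHS_sub_le {p π : Fin 2 → ℝ} (hπ : π ∈ box) {β : ℝ} (hβ : 0 ≤ β) (l1 l2 l3 : ℝ)
    {V V' : (Fin 2 → ℝ) → ℝ} {a : Bits} {C : ℝ}
    (h : ∀ u, |V (update p π a u) - V' (update p π a u)| ≤ C) :
    |bellmanRHS p β l1 l2 l3 V π a - bellmanRHS p β l1 l2 l3 V' π a| ≤ β * C := by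
  have := expectedNext_sub_le hπ h
  rw [bellmanRHS, bellmanRHS, add_sub_add_left_eq_sub, ← mul_sub, abs_mul, abs_of_nonneg hβ]
  exact mul_le_mul_of_nonneg_left this hβ

lemma bellmanRHS_congr {p π : Fin 2 → ℝ} (β l1 l2 l3 : ℝ) {V V' : (Fin 2 → ℝ) → ℝ} {a : Bits}
    (h : ∀ u, V (update p π a u) = V' (update p π a u)) :
    bellmanRHS p β l1 l2 l3 V π a = bellmanRHS p β l1 l2 l3 V' π a := by
  simp [bellmanRHS, expectedNext, h]

/-! ### Uniqueness and existence of the solution of the dynamic program -/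

/-- `V` is a bounded solution of the dynamic program on the set `S`. -/
def SolvesOn (S : Set (Fin 2 → ℝ)) (p : Fin 2 → ℝ) (β l1 l2 l3 : ℝ) (V : (Fin 2 → ℝ) → ℝ) :
    Prop :=
  (∃ C : ℝ, ∀ π ∈ S, |V π| ≤ C) ∧
    ∀ π ∈ S, IsLeast (bellmanRHS p β l1 l2 l3 V π '' actions) (V π)

lemma SolvesOn.le {S : Set (Fin 2 → ℝ)} {p : Fin 2 → ℝ} {β l1 l2 l3 : ℝ}
    {V : (Fin 2 → ℝ) → ℝ} (h : SolvesOn S p β l1 l2 l3 V) {π : Fin 2 → ℝ} (hπ : π ∈ S) {a : Bits}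
    (ha : a ∈ actions) : V π ≤ bellmanRHS p β l1 l2 l3 V π a :=
  (h.2 π hπ).2 ⟨a, ha, rfl⟩

lemma SolvesOn.exists_eq {S : Set (Fin 2 → ℝ)} {p : Fin 2 → ℝ} {β l1 l2 l3 : ℝ}
    {V : (Fin 2 → ℝ) → ℝ} (h : SolvesOn S p β l1 l2 l3 V) {π : Fin 2 → ℝ} (hπ : π ∈ S) :
    ∃ a ∈ actions, bellmanRHS p β l1 l2 l3 V π a = V π :=
  (h.2 π hπ).1

lemma SolvesOn.mono {S S' : Set (Fin 2 → ℝ)} {p : Fin 2 → ℝ} {β l1 l2 l3 : ℝ}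
    {V : (Fin 2 → ℝ) → ℝ} (h : SolvesOn S p β l1 l2 l3 V) (hS : S' ⊆ S) :
    SolvesOn S' p β l1 l2 l3 V :=
  ⟨h.1.imp fun _ hC π hπ => hC π (hS hπ), fun π hπ => h.2 π (hS hπ)⟩

/-- A minimizing action for `V'` is a test action for `V`, and `bellmanRHS` contracts differences by
`β`. -/
lemma SolvesOn.sub_le {S : Set (Fin 2 → ℝ)} {p : Fin 2 → ℝ} (hS : S ⊆ box)
    (hup : ∀ π ∈ S, ∀ a ∈ actions, ∀ u, update p π a u ∈ S) {β l1 l2 l3 : ℝ} (hβ : 0 ≤ β)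
    {V V' : (Fin 2 → ℝ) → ℝ} (h : SolvesOn S p β l1 l2 l3 V) (h' : SolvesOn S p β l1 l2 l3 V')
    {C : ℝ} (hC : ∀ π ∈ S, |V π - V' π| ≤ C) {π : Fin 2 → ℝ} (hπ : π ∈ S) :
    V π - V' π ≤ β * C := by
  obtain ⟨a, ha, hVa⟩ := h'.exists_eq hπ
  have h1 := h.le hπ ha
  have h2 := (abs_le.1 (bellmanRHS_sub_le (hS hπ) hβ l1 l2 l3
    (fun u => hC _ (hup π hπ a ha u)))).2
  linarith

lemma SolvesOn.eqOn {S : Set (Fin 2 → ℝ)} {p : Fin 2 → ℝ} (hS : S ⊆ box)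
    (hup : ∀ π ∈ S, ∀ a ∈ actions, ∀ u, update p π a u ∈ S) {β l1 l2 l3 : ℝ}
    (hβ : β ∈ Set.Ioo (0 : ℝ) 1) {V V' : (Fin 2 → ℝ) → ℝ} (h : SolvesOn S p β l1 l2 l3 V)
    (h' : SolvesOn S p β l1 l2 l3 V') : Set.EqOn V V' S := by
  obtain ⟨C, hC⟩ := h.1
  obtain ⟨C', hC'⟩ := h'.1
  have key (n : ℕ) : ∀ π ∈ S, |V π - V' π| ≤ β ^ n * (C + C') := by
    induction n with
    | zero =>
      intro π hπ
      rw [pow_zero, one_mul]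
      exact (abs_sub _ _).trans (add_le_add (hC π hπ) (hC' π hπ))
    | succ n ih =>
      intro π hπ
      rw [pow_succ', mul_assoc, abs_le]
      have h1 := h.sub_le hS hup hβ.1.le h' ih hπ
      have h2 := h'.sub_le hS hup hβ.1.le h (fun π hπ => by rw [abs_sub_comm]; exact ih π hπ) hπ
      constructor <;> linarith
  intro π hπ
  have hlim : Filter.Tendsto (fun n : ℕ => β ^ n * (C + C')) Filter.atTop (nhds 0) := by
    simpa using (tendsto_pow_atTop_nhds_zero_of_lt_one hβ.1.le hβ.2).mul_const (C + C')
  have := ge_of_tendsto' hlim fun n => key n π hπ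
  exact sub_eq_zero.1 (abs_nonpos_iff.1 this)

/-- The Bellman operator on functions of the information state. -/
def bellman (p : Fin 2 → ℝ) (β l1 l2 l3 : ℝ) (V : (Fin 2 → ℝ) → ℝ) (π : Fin 2 → ℝ) : ℝ :=
  min (bellmanRHS p β l1 l2 l3 V π ![false, true])
    (min (bellmanRHS p β l1 l2 l3 V π ![true, false]) (bellmanRHS p β l1 l2 l3 V π ![true, true]))

lemma isLeast_bellman (p : Fin 2 → ℝ) (β l1 l2 l3 : ℝ) (V : (Fin 2 → ℝ) → ℝ) (π : Fin 2 → ℝ) :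
    IsLeast (bellmanRHS p β l1 l2 l3 V π '' actions) (bellman p β l1 l2 l3 V π) := by
  simp only [actions, Set.image_insert_eq, Set.image_singleton]
  exact (isLeast_singleton.insert _).insert _

lemma abs_bellman_sub_le {p π : Fin 2 → ℝ} (hp : p ∈ box) (hπ : π ∈ box) {β : ℝ} (hβ : 0 ≤ β)
    (l1 l2 l3 : ℝ) {V V' : (Fin 2 → ℝ) → ℝ} {C : ℝ} (h : ∀ π ∈ box, |V π - V' π| ≤ C) :
    |bellman p β l1 l2 l3 V π - bellman p β l1 l2 l3 V' π| ≤ β * C := by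
  have key (a : Bits) := bellmanRHS_sub_le hπ hβ l1 l2 l3
    (fun u => h _ (update_mem_box hp hπ a u))
  refine (abs_min_sub_min_le_max _ _ _ _).trans (max_le (key _) ?_)
  exact (abs_min_sub_min_le_max _ _ _ _).trans (max_le (key _) (key _))

lemma abs_stageCost_le (l1 l2 l3 : ℝ) (u : Bits) :
    |stageCost l1 l2 l3 u| ≤ |l1| + |l2| + |l3| := by
  have p1 := abs_nonneg l1
  have p2 := abs_nonneg l2
  have p3 := abs_nonneg l3
  unfold stageCost
  split
  · rw [abs_zero]; positivity
  all_goals linarith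

lemma sum_stateProb_mul_stageCost (π : Fin 2 → ℝ) (l1 l2 l3 : ℝ) (a : Bits) :
    ∑ x, stateProb π x * stageCost l1 l2 l3 (transmit a x) = expectedCost l1 l2 l3 π a := by
  rcases bits_cases a with rfl | rfl | rfl | rfl <;>
    simp [sum_bits, stateProb, Fin.prod_univ_two, transmit, stageCost, expectedCost] <;> ring

lemma abs_expectedCost_le {π : Fin 2 → ℝ} (hπ : π ∈ box) (l1 l2 l3 : ℝ) (a : Bits) :
    |expectedCost l1 l2 l3 π a| ≤ |l1| + |l2| + |l3| := by
  rw [← sum_stateProb_mul_stageCost]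
  calc _ ≤ ∑ x, |stateProb π x * stageCost l1 l2 l3 (transmit a x)| :=
        Finset.abs_sum_le_sum_abs _ _
    _ ≤ ∑ x, stateProb π x * (|l1| + |l2| + |l3|) := by
        refine Finset.sum_le_sum fun x _ => ?_
        rw [abs_mul, abs_of_nonneg (stateProb_nonneg hπ x)]
        exact mul_le_mul_of_nonneg_left (abs_stageCost_le _ _ _ _) (stateProb_nonneg hπ x)
    _ = _ := by rw [← Finset.sum_mul, sum_stateProb, one_mul]

lemma abs_bellman_le {p π : Fin 2 → ℝ} (hp : p ∈ box) (hπ : π ∈ box) {β : ℝ} (hβ : 0 ≤ β)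
    (l1 l2 l3 : ℝ) {V : (Fin 2 → ℝ) → ℝ} {C : ℝ} (h : ∀ π ∈ box, |V π| ≤ C) :
    |bellman p β l1 l2 l3 V π| ≤ |l1| + |l2| + |l3| + β * C := by
  obtain ⟨a, -, ha⟩ := (isLeast_bellman p β l1 l2 l3 V π).1
  rw [← ha]
  refine (abs_add_le _ _).trans (add_le_add (abs_expectedCost_le hπ l1 l2 l3 a) ?_)
  rw [abs_mul, abs_of_nonneg hβ]
  have := expectedNext_sub_le (V := V) (V' := fun _ => 0) (a := a) (C := C) (p := p) hπ
    (fun u => by simpa using h _ (update_mem_box hp hπ a u))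
  refine mul_le_mul_of_nonneg_left ?_ hβ
  simpa [expectedNext] using this

open Classical in
/-- The extension by zero of a function on the unit box. -/
def extend (V : box → ℝ) (π : Fin 2 → ℝ) : ℝ := if h : π ∈ box then V ⟨π, h⟩ else 0

lemma extend_of_mem (V : box → ℝ) {π : Fin 2 → ℝ} (h : π ∈ box) : extend V π = V ⟨π, h⟩ :=
  dif_pos h

lemma exists_solvesOn_box {p : Fin 2 → ℝ} (hp : p ∈ box) {β : ℝ} (hβ : β ∈ Set.Ioo (0 : ℝ) 1)
    (l1 l2 l3 : ℝ) : ∃ V, SolvesOn box p β l1 l2 l3 V := by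
  -- With the discrete topology every bounded function is continuous, so the bounded functions on
  -- the box form a complete metric space for Banach's theorem.
  let _ : TopologicalSpace box := ⊥
  have : DiscreteTopology box := ⟨rfl⟩
  have hb (V : BoundedContinuousFunction box ℝ) : ∀ π ∈ box, |extend V π| ≤ ‖V‖ := by
    intro π hπ
    rw [extend_of_mem _ hπ]
    exact V.norm_coe_le_norm _
  let F (V : BoundedContinuousFunction box ℝ) : BoundedContinuousFunction box ℝ :=
    BoundedContinuousFunction.ofNormedAddCommGroupDiscrete
      (fun π : box => bellman p β l1 l2 l3 (extend V) π) (|l1| + |l2| + |l3| + β * ‖V‖)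
      (fun π => abs_bellman_le hp π.2 hβ.1.le l1 l2 l3 (hb V))
  have hF : ContractingWith ⟨β, hβ.1.le⟩ F := by
    refine ⟨hβ.2, LipschitzWith.of_dist_le_mul fun V V' => ?_⟩
    refine (BoundedContinuousFunction.dist_le (mul_nonneg hβ.1.le dist_nonneg)).2 fun π => ?_
    refine abs_bellman_sub_le hp π.2 hβ.1.le l1 l2 l3 fun π hπ => ?_
    rw [extend_of_mem _ hπ, extend_of_mem _ hπ]
    exact BoundedContinuousFunction.dist_coe_le_dist (f := V) (g := V') ⟨π, hπ⟩
  obtain ⟨V, hV⟩ : ∃ V, F V = V := ⟨_, hF.fixedPoint_isFixedPt⟩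
  refine ⟨extend V, ⟨‖V‖, hb V⟩, fun π hπ => ?_⟩
  have h : extend V π = bellman p β l1 l2 l3 (extend V) π := by
    rw [extend_of_mem _ hπ]
    exact (DFunLike.congr_fun hV ⟨π, hπ⟩).symm
  rw [h]
  exact isLeast_bellman p β l1 l2 l3 (extend V) π

/-! ### Idling is never strictly better -/

lemma bellmanRHS_idle (p : Fin 2 → ℝ) (β l1 l2 l3 : ℝ) (V : (Fin 2 → ℝ) → ℝ) (π : Fin 2 → ℝ) :
    bellmanRHS p β l1 l2 l3 V π ![false, false] = β * V ![opT (p 0) (π 0), opT (p 1) (π 1)] := by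
  rw [bellmanRHS, expectedNext_idle]
  exact zero_add _

lemma bellmanRHS_fst (p : Fin 2 → ℝ) (β l1 l2 l3 : ℝ) (V : (Fin 2 → ℝ) → ℝ) (π : Fin 2 → ℝ) :
    bellmanRHS p β l1 l2 l3 V π ![true, false] = l1 * π 0 + β * V ![p 0, opT (p 1) (π 1)] := by
  rw [bellmanRHS, expectedNext_fst]
  rfl

lemma bellmanRHS_snd (p : Fin 2 → ℝ) (β l1 l2 l3 : ℝ) (V : (Fin 2 → ℝ) → ℝ) (π : Fin 2 → ℝ) :
    bellmanRHS p β l1 l2 l3 V π ![false, true] = l2 * π 1 + β * V ![opT (p 0) (π 0), p 1] := by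
  rw [bellmanRHS, expectedNext_snd]
  rfl

lemma bellmanRHS_both (p : Fin 2 → ℝ) (β l1 l2 l3 : ℝ) (V : (Fin 2 → ℝ) → ℝ) (π : Fin 2 → ℝ) :
    bellmanRHS p β l1 l2 l3 V π ![true, true] =
      l1 * π 0 + l2 * π 1 + (l3 - l1 - l2) * (π 0 * π 1) +
        β * (π 0 * π 1 * V ![1, 1] + (1 - π 0 * π 1) * V p) := by
  rw [bellmanRHS, expectedNext_both]
  rfl

/-- Iterating the inequality gives the geometric series `c / (1 - β)`, and the upper bound on `f`
kills the remainder. -/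
lemma le_of_forall_le_add_mul {f : ℕ → ℝ} {β c C : ℝ} (hβ : β ∈ Set.Ioo (0 : ℝ) 1)
    (hC : ∀ n, f n ≤ C) (h : ∀ n, f n ≤ c + β * f (n + 1)) : (1 - β) * f 0 ≤ c := by
  have key (n : ℕ) : ∀ m, (1 - β) * f m ≤ c + β ^ n * ((1 - β) * C - c) := by
    induction n with
    | zero =>
      intro m
      have := mul_le_mul_of_nonneg_left (hC m) (sub_nonneg.2 hβ.2.le)
      linarith
    | succ n ih =>
      intro m
      have h1 := mul_le_mul_of_nonneg_left (h m) (sub_nonneg.2 hβ.2.le)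
      have h2 := mul_le_mul_of_nonneg_left (ih (m + 1)) hβ.1.le
      rw [pow_succ]
      linarith
  have hlim : Filter.Tendsto (fun n : ℕ => c + β ^ n * ((1 - β) * C - c)) Filter.atTop
      (nhds c) := by
    simpa using ((tendsto_pow_atTop_nhds_zero_of_lt_one hβ.1.le hβ.2).mul_const
      ((1 - β) * C - c)).const_add c
  exact ge_of_tendsto' hlim fun n => key n 0

/-- A bound on the value of two extra packets, in terms of the values `wp` of the initial
information state, `w` of two full buffers, `wa` of a full buffer of the second user, and `wT` of
the information state after the second user has transmitted. -/
lemma gap_nonpos_of_first {β l1 l2 l3 r w wp wa wT : ℝ} (hβ : β ∈ Set.Ioo (0 : ℝ) 1)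
    (hr : r ∈ Set.Icc (0 : ℝ) 1) (hl1 : l1 ≤ 0) (hl2 : l2 ≤ 0) (hl3 : 0 ≤ l3)
    (hp : (1 - β) * wp ≤ l1 * r) (hT : wp ≤ β * wT) (hw : w = l1 + β * wa)
    (ha : wa = l1 * r + β * wa ∨ wa = l2 + β * wT ∨
      wa = l2 * (1 - r) + l3 * r + β * (r * w + (1 - r) * wp)) :
    l1 + l2 + β * (wp - w) ≤ 0 := by
  obtain ⟨hβ0, hβ1⟩ := hβ
  obtain ⟨hr0, hr1⟩ := hr
  have hwp : wp ≤ 0 := by nlinarith [mul_nonneg (neg_nonneg.2 hl1) hr0]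
  have weak (h : l2 + wp ≤ wa) : l1 + l2 + β * (wp - w) ≤ 0 := by
    have h1 := mul_le_mul_of_nonneg_left h hβ0.le
    have h2 : l1 + β * l2 + β * wp ≤ w := by linarith
    have h3 := mul_le_mul_of_nonneg_left h2 hβ0.le
    nlinarith [mul_nonneg (sub_nonneg.2 hβ1.le) (neg_nonneg.2 hl1),
      mul_nonneg (mul_nonneg hβ0.le (sub_nonneg.2 hβ1.le)) (neg_nonneg.2 hwp),
      mul_nonneg (sub_nonneg.2 (mul_le_one₀ hβ1.le hβ0.le hβ1.le)) (neg_nonneg.2 hl2)]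
  rcases ha with ha | ha | ha
  · apply weak
    have : (1 - β) * wp ≤ (1 - β) * wa := by linarith
    have := le_of_mul_le_mul_left this (sub_pos.2 hβ1)
    linarith
  · apply weak
    linarith
  -- Here `w` recurs inside `wa`. Solving the linear equation for `w` produces the factor `1 - β²r`;
  -- with `hp`, the gap times this factor is at most `(1-β+βr) l1 + (1-β²) l2 - β² r l3`.
  · have hpos : 0 < 1 - β * β * r := by nlinarith [mul_le_one₀ hβ1.le hβ0.le hβ1.le]
    have key : (1 - β * β * r) * (l1 + l2 + β * (wp - w)) ≤ 0 := by
      have e : (1 - β * β * r) * (wp - w) =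
          (1 + β) * ((1 - β) * wp) - l1 - β * (1 - r) * l2 - β * l3 * r := by
        rw [ha] at hw
        linear_combination hw * (-1)
      have e2 : (1 - β * β * r) * (l1 + l2 + β * (wp - w)) =
          (1 - β * β * r) * (l1 + l2) +
            β * ((1 + β) * ((1 - β) * wp) - l1 - β * (1 - r) * l2 - β * l3 * r) := by
        rw [← e]; ring
      rw [e2]
      have h1 := mul_le_mul_of_nonneg_left hp (mul_nonneg hβ0.le (by linarith : 0 ≤ 1 + β))
      have h2 : 0 ≤ β * β * l3 * r := by positivity
      have h3 : 0 ≤ (1 - β) * (-l1) := mul_nonneg (by linarith) (by linarith)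
      have h4 : 0 ≤ β * r * (-l1) := mul_nonneg (by positivity) (by linarith)
      have h5 : 0 ≤ (1 - β * β) * (-l2) :=
        mul_nonneg (sub_nonneg.2 (mul_le_one₀ hβ1.le hβ0.le hβ1.le)) (by linarith)
      nlinarith
    exact nonpos_of_mul_nonpos_right key hpos

/-- Letting only the first user transmit forever keeps its coordinate at `p 0` and costs `l1 * p 0`
at every step. -/
lemma SolvesOn.fst_bound {p : Fin 2 → ℝ} (hp : p ∈ box) {β l1 l2 l3 : ℝ}
    (hβ : β ∈ Set.Ioo (0 : ℝ) 1) {V : (Fin 2 → ℝ) → ℝ} (h : SolvesOn box p β l1 l2 l3 V) :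
    (1 - β) * V p ≤ l1 * p 0 := by
  obtain ⟨C, hC⟩ := h.1
  have hm (n : ℕ) : ![p 0, (opT (p 1))^[n] (p 1)] ∈ box :=
    mk_mem_box (hp 0) (opT_iterate_mem_Icc (hp 1) n)
  have := le_of_forall_le_add_mul (f := fun n => V ![p 0, (opT (p 1))^[n] (p 1)]) hβ
    (fun n => (abs_le.1 (hC _ (hm n))).2) (c := l1 * p 0) fun n => by
      have := h.le (hm n) (a := ![true, false]) (by simp [actions])
      rw [bellmanRHS_fst] at this
      simpa only [Function.iterate_succ_apply', Matrix.cons_val_zero, Matrix.cons_val_one] using this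
  simpa [eta_two] using this

lemma SolvesOn.snd_bound {p : Fin 2 → ℝ} (hp : p ∈ box) {β l1 l2 l3 : ℝ}
    (hβ : β ∈ Set.Ioo (0 : ℝ) 1) {V : (Fin 2 → ℝ) → ℝ} (h : SolvesOn box p β l1 l2 l3 V) :
    (1 - β) * V p ≤ l2 * p 1 := by
  obtain ⟨C, hC⟩ := h.1
  have hm (n : ℕ) : ![(opT (p 0))^[n] (p 0), p 1] ∈ box :=
    mk_mem_box (opT_iterate_mem_Icc (hp 0) n) (hp 1)
  have := le_of_forall_le_add_mul (f := fun n => V ![(opT (p 0))^[n] (p 0), p 1]) hβ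
    (fun n => (abs_le.1 (hC _ (hm n))).2) (c := l2 * p 1) fun n => by
      have := h.le (hm n) (a := ![false, true]) (by simp [actions])
      rw [bellmanRHS_snd] at this
      simpa only [Function.iterate_succ_apply', Matrix.cons_val_zero, Matrix.cons_val_one] using this
  simpa [eta_two] using this

/-- The optimal action at `(1, 1)` decides. If a single user transmits, `gap_nonpos_of_first`
applies, up to exchanging the users. If both do, the state returns to `(1, 1)`, so `(1 - β) V(1, 1)
= l3 ≥ 0`, whereas `V p ≤ 0`. -/
lemma SolvesOn.gap_nonpos {p : Fin 2 → ℝ} (hp : p ∈ box) {β l1 l2 l3 : ℝ}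
    (hβ : β ∈ Set.Ioo (0 : ℝ) 1) (hl1 : l1 ≤ 0) (hl2 : l2 ≤ 0) (hl3 : 0 ≤ l3)
    {V : (Fin 2 → ℝ) → ℝ} (h : SolvesOn box p β l1 l2 l3 V) :
    l1 + l2 + β * (V p - V ![1, 1]) ≤ 0 := by
  have hb1 := h.fst_bound hp hβ
  have hb2 := h.snd_bound hp hβ
  have hT0 : V p ≤ β * V ![opT (p 0) (p 0), p 1] := by
    have := h.le hp (a := ![false, true]) (by simp [actions])
    rw [bellmanRHS_snd] at this
    nlinarith [mul_nonneg (neg_nonneg.2 hl2) (hp 1).1]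
  have hT1 : V p ≤ β * V ![p 0, opT (p 1) (p 1)] := by
    have := h.le hp (a := ![true, false]) (by simp [actions])
    rw [bellmanRHS_fst] at this
    nlinarith [mul_nonneg (neg_nonneg.2 hl1) (hp 0).1]
  have h1 := one_mem_Icc
  obtain ⟨a, ha, e⟩ := h.exists_eq (mk_mem_box h1 h1)
  rcases ha with rfl | rfl | rfl
  · rw [bellmanRHS_snd] at e
    have hw : V ![1, 1] = l2 + β * V ![1, p 1] := by
      rw [← e]
      simp [opT_one]
    have hs := gap_nonpos_of_first hβ (hp 1) hl2 hl1 hl3 hb2 hT1 hw (by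
      obtain ⟨a, ha, e⟩ := h.exists_eq (mk_mem_box h1 (hp 1))
      rcases ha with rfl | rfl | rfl
      · left
        rw [bellmanRHS_snd] at e
        simpa [opT_one] using e.symm
      · right; left
        rw [bellmanRHS_fst] at e
        simpa [opT_one] using e.symm
      · right; right
        rw [bellmanRHS_both] at e
        simp only [Matrix.cons_val_zero, Matrix.cons_val_one] at e
        rw [← e]
        ring)
    linarith
  · rw [bellmanRHS_fst] at e
    have hw : V ![1, 1] = l1 + β * V ![p 0, 1] := by
      rw [← e]
      simp [opT_one]
    exact gap_nonpos_of_first hβ (hp 0) hl1 hl2 hl3 hb1 hT0 hw (by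
      obtain ⟨a, ha, e⟩ := h.exists_eq (mk_mem_box (hp 0) h1)
      rcases ha with rfl | rfl | rfl
      · right; left
        rw [bellmanRHS_snd] at e
        simpa [opT_one] using e.symm
      · left
        rw [bellmanRHS_fst] at e
        simpa [opT_one] using e.symm
      · right; right
        rw [bellmanRHS_both] at e
        simp only [Matrix.cons_val_zero, Matrix.cons_val_one] at e
        rw [← e]
        ring)
  · rw [bellmanRHS_both] at e
    simp only [Matrix.cons_val_zero, Matrix.cons_val_one] at e
    have hβ1 : 0 < 1 - β := sub_pos.2 hβ.2
    have hw : 0 ≤ V ![1, 1] := by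
      by_contra! hneg
      nlinarith
    have hwp : V p ≤ 0 := by nlinarith [mul_nonneg (neg_nonneg.2 hl1) (hp 0).1]
    nlinarith [hβ.1]

lemma SolvesOn.le_idle {p : Fin 2 → ℝ} (hp : p ∈ box) {β l1 l2 l3 : ℝ}
    (hβ : β ∈ Set.Ioo (0 : ℝ) 1) (hl1 : l1 ≤ 0) (hl2 : l2 ≤ 0) (hl3 : 0 ≤ l3)
    {V : (Fin 2 → ℝ) → ℝ} (h : SolvesOn box p β l1 l2 l3 V) {π : Fin 2 → ℝ} (hπ : π ∈ box) :
    V π ≤ bellmanRHS p β l1 l2 l3 V π ![false, false] := by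
  rw [bellmanRHS_idle]
  have hgap := h.gap_nonpos hp hβ hl1 hl2 hl3
  obtain ⟨hβ0, hβ1⟩ := hβ
  set x := π 0 with hx
  set y := π 1 with hy
  obtain ⟨hx0, hx1⟩ : x ∈ Set.Icc (0 : ℝ) 1 := hπ 0
  obtain ⟨hy0, hy1⟩ : y ∈ Set.Icc (0 : ℝ) 1 := hπ 1
  have hTx := opT_mem_Icc (hp 0) (hπ 0)
  have hTy := opT_mem_Icc (hp 1) (hπ 1)
  have hp0 := hp 0
  have hp1 := hp 1
  have htx : opT (p 0) x = x + p 0 - p 0 * x := by unfold opT; ring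
  have hty : opT (p 1) y = y + p 1 - p 1 * y := by unfold opT; ring
  have hfst := h.le hπ (a := ![true, false]) (by simp [actions])
  have hsnd := h.le hπ (a := ![false, true]) (by simp [actions])
  rw [bellmanRHS_fst] at hfst
  rw [bellmanRHS_snd] at hsnd
  obtain ⟨a, ha, e⟩ := h.exists_eq (mk_mem_box hTx hTy)
  rcases ha with rfl | rfl | rfl
  -- The second user transmits now and again one step later. Both plans reach the same state after
  -- two steps, and this one is cheaper by `-l2 * ((1-β) y + β p₁ y)`.
  · have h2 := h.le (mk_mem_box hTx hp1) (a := ![false, true]) (by simp [actions])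
    rw [bellmanRHS_snd] at e h2
    simp only [Matrix.cons_val_zero, Matrix.cons_val_one] at e h2
    rw [← e]
    have h3 := mul_le_mul_of_nonneg_left h2 hβ0.le
    have h4 : 0 ≤ (-l2) * ((1 - β) * y + β * (p 1 * y)) :=
      mul_nonneg (by linarith) (add_nonneg (mul_nonneg (by linarith) hy0)
        (mul_nonneg hβ0.le (mul_nonneg hp1.1 hy0)))
    rw [← hx, ← hy] at *
    rw [hty] at *
    linarith
  · have h2 := h.le (mk_mem_box hp0 hTy) (a := ![true, false]) (by simp [actions])
    rw [bellmanRHS_fst] at e h2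
    simp only [Matrix.cons_val_zero, Matrix.cons_val_one] at e h2
    rw [← e]
    have h3 := mul_le_mul_of_nonneg_left h2 hβ0.le
    have h4 : 0 ≤ (-l1) * ((1 - β) * x + β * (p 0 * x)) :=
      mul_nonneg (by linarith) (add_nonneg (mul_nonneg (by linarith) hx0)
        (mul_nonneg hβ0.le (mul_nonneg hp0.1 hx0)))
    rw [← hx, ← hy] at *
    rw [htx] at *
    linarith
  -- The first user transmits now, then both do. This lowers the collision probability by `x (1 - p
  -- 0) z`, and `hgap` with `l3 ≥ 0` shows that a collision is no better than two successes.
  · have h2 := h.le (mk_mem_box hp0 hTy) (a := ![true, true]) (by simp [actions])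
    rw [bellmanRHS_both] at e h2
    simp only [Matrix.cons_val_zero, Matrix.cons_val_one] at e h2
    rw [← e]
    have h3 := mul_le_mul_of_nonneg_left h2 hβ0.le
    have hq : 0 ≤ x * (1 - p 0) := mul_nonneg hx0 (by linarith [hp0.2])
    have hTy0 := hTy.1
    rw [← hy] at *
    set z := opT (p 1) y
    have h4 : 0 ≤ β * (x * (1 - p 0)) * (z * (l3 - (l1 + l2 + β * (V p - V ![1, 1])))) :=
      mul_nonneg (mul_nonneg hβ0.le hq) (mul_nonneg hTy0 (by linarith))
    have h5 : 0 ≤ (-l1) * (x * (1 - β * (1 - p 0))) := by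
      refine mul_nonneg (by linarith) (mul_nonneg hx0 ?_)
      nlinarith [hp0.1, hp0.2]
    rw [← hx] at *
    rw [htx]
    nlinarith

/-! ### The information state of a general strategy and its Bayesian update -/

/-- The information state computed from the common information under a general strategy. -/
def belief (p : Fin 2 → ℝ) (g : Strategy) : List Bits → (Fin 2 → ℝ)
  | [] => p
  | u :: h => update p (belief p g h) (prescribed g h) u

lemma belief_mem_box {p : Fin 2 → ℝ} (hp : p ∈ box) (g : Strategy) (h : List Bits) :
    belief p g h ∈ box := by
  induction h with
  | nil => exact hp
  | cons u h ih => exact update_mem_box hp ih _ _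

lemma prescribed_stationaryStrategy (p : Fin 2 → ℝ) (ψ : (Fin 2 → ℝ) → Bits) (h : List Bits) :
    prescribed (stationaryStrategy p ψ) h = ψ (infoState p ψ h) := by
  ext i
  simp [prescribed, stationaryStrategy]

lemma belief_stationaryStrategy (p : Fin 2 → ℝ) (ψ : (Fin 2 → ℝ) → Bits) (h : List Bits) :
    belief p (stationaryStrategy p ψ) h = infoState p ψ h := by
  induction h with
  | nil => rfl
  | cons u h ih => rw [belief, ih, prescribed_stationaryStrategy, infoState]

lemma feasible_stationaryStrategy (p : Fin 2 → ℝ) (ψ : (Fin 2 → ℝ) → Bits) :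
    Feasible (stationaryStrategy p ψ) := fun _ _ => Bool.and_false _

lemma Feasible.apply_eq {g : Strategy} (hg : Feasible g) (i : Fin 2) (h : List Bits) (x : Bool) :
    g i h x = (prescribed g h i && x) := by
  cases x
  · rw [hg, Bool.and_false]
  · rw [Bool.and_true, prescribed]

lemma trajectory_congr (g : Strategy) (x : Bits) {w w' : ℕ → Bits} {t : ℕ}
    (h : ∀ s < t, w s = w' s) : trajectory g x w t = trajectory g x w' t := by
  induction t with
  | zero => rfl
  | succ t ih =>
    rw [trajectory, trajectory, ih fun s hs => h s (hs.trans t.lt_succ_self), h t t.lt_succ_self]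

/-- The finite set of all possible histories at time `t`. -/
def histories : ℕ → Finset (List Bits)
  | 0 => {[]}
  | t + 1 => (Finset.univ ×ˢ histories t).image fun q : Bits × List Bits => q.1 :: q.2

lemma trajectory_snd_mem (g : Strategy) (x : Bits) (w : ℕ → Bits) (t : ℕ) :
    (trajectory g x w t).2 ∈ histories t := by
  induction t with
  | zero => exact Finset.mem_singleton_self _
  | succ t ih =>
    exact Finset.mem_image.2 ⟨(fun i => g i (trajectory g x w t).2 ((trajectory g x w t).1 i), _),
      Finset.mem_product.2 ⟨Finset.mem_univ _, ih⟩, rfl⟩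

lemma bits_ext_iff (a b c d : Bool) : (![a, b] : Bits) = ![c, d] ↔ a = c ∧ b = d := by
  simp

lemma transmit_mk (a b c d : Bool) : transmit ![a, b] ![c, d] = ![a && c, b && d] := by
  ext i
  fin_cases i <;> rfl

lemma nextState_mk (x y u v w z : Bool) : nextState ![x, y] ![u, v] ![w, z] =
    ![x && !u || u && v || w, y && !v || u && v || z] := by
  revert x y u v w z
  decide

lemma stateProb_mk (π : Fin 2 → ℝ) (x y : Bool) : stateProb π ![x, y] =
    (if x = true then π 0 else 1 - π 0) * (if y = true then π 1 else 1 - π 1) := by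
  exact Fin.prod_univ_two _

/-- One step of the Bayesian filter of the buffer states. -/
lemma step_stateProb (p b : Fin 2 → ℝ) (a u y : Bits) :
    ∑ x, ∑ w, (if transmit a x = u ∧ nextState x u w = y then stateProb b x * stateProb p w else 0) =
      (∑ x, if transmit a x = u then stateProb b x else 0) * stateProb (update p b a u) y := by
  have hu : ![u 0, u 1] = u := by
    ext i
    fin_cases i <;> rfl
  have hy : ![y 0, y 1] = y := by
    ext i
    fin_cases i <;> rfl
  rw [← hu, ← hy]
  generalize u 0 = u0, u 1 = u1, y 0 = y0, y 1 = y1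
  simp only [sum_bits, nextState_mk, stateProb_mk]
  -- The product form survives because a user told to transmit reveals its buffer, while a silent
  -- one reveals nothing. For decisions `u` that `a` cannot produce, both sides vanish.
  rcases bits_cases a with rfl | rfl | rfl | rfl <;>
  simp only [transmit_mk, bits_ext_iff] <;>
  cases u0 <;> cases u1 <;> cases y0 <;> cases y1 <;>
  simp [update, opT] <;>
  ring

/-! ### Independence of new arrivals and the conditional law of the buffers -/

section Probability

variable {Ω : Type*} {X₁ : Fin 2 → Ω → Bool} {W : ℕ → Fin 2 → Ω → Bool}

lemma history_mem (g : Strategy) (t : ℕ) (ω : Ω) : history X₁ W g t ω ∈ histories t :=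
  trajectory_snd_mem _ _ _ _

lemma decision_eq_transmit {g : Strategy} (hg : Feasible g) (t : ℕ) (ω : Ω) :
    decision X₁ W g t ω =
      transmit (prescribed g (history X₁ W g t ω)) (bufferState X₁ W g t ω) := by
  ext i
  exact hg.apply_eq i _ _

/-- The event that the history is `h` and the buffer states are `x` at time `t`. -/
def stateEvent (X₁ : Fin 2 → Ω → Bool) (W : ℕ → Fin 2 → Ω → Bool) (g : Strategy) (t : ℕ)
    (h : List Bits) (x : Bits) : Set Ω :=
  {ω | history X₁ W g t ω = h ∧ bufferState X₁ W g t ω = x}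

/-- The state at time `t` depends only on the initial states and the arrivals before `t`. This
finite cylinder form yields both measurability and independence from the arrivals at time `t`. -/
lemma exists_stateEvent_eq (X₁ : Fin 2 → Ω → Bool) (W : ℕ → Fin 2 → Ω → Bool) (g : Strategy)
    (t : ℕ) (h : List Bits) (x : Bits) :
    ∃ S : Finset (Fin 2 ⊕ ℕ × Fin 2), (∀ i, Sum.inr (t, i) ∉ S) ∧ ∃ A : Set (S → Bool),
      stateEvent X₁ W g t h x = (fun ω (i : S) =>
        (Sum.elim X₁ (fun q : ℕ × Fin 2 => W q.1 q.2)) i ω) ⁻¹' A := by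
  let S : Finset (Fin 2 ⊕ ℕ × Fin 2) := Finset.univ.disjSum (Finset.range t ×ˢ Finset.univ)
  have h0 (i : Fin 2) : Sum.inl i ∈ S := by simp [S]
  have hW (s : ℕ) (hs : s < t) (i : Fin 2) : Sum.inr (s, i) ∈ S := by simp [S, hs]
  -- The value `false` for arrivals from time `t` on is arbitrary: `trajectory_congr` shows that
  -- they do not matter.
  let φ (v : S → Bool) : Bits × List Bits := trajectory g (fun i => v ⟨Sum.inl i, h0 i⟩)
    (fun s i => if hs : s < t then v ⟨Sum.inr (s, i), hW s hs i⟩ else false) t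
  refine ⟨S, by simp [S], {v | (φ v).2 = h ∧ (φ v).1 = x}, ?_⟩
  have key (ω : Ω) : trajectory g (fun i => X₁ i ω) (fun s i => W s i ω) t =
      φ (fun i : S => (Sum.elim X₁ (fun q : ℕ × Fin 2 => W q.1 q.2)) i ω) := by
    refine trajectory_congr _ _ fun s hs => ?_
    ext i
    simp [hs]
  ext ω
  simp only [stateEvent, history, bufferState, key, Set.mem_ofPred_eq, Set.mem_preimage]

variable [MeasurableSpace Ω] {P : Measure Ω} {p : Fin 2 → ℝ}

lemma PrimitiveLaw.measurable (hprim : PrimitiveLaw P p X₁ W) (i : Fin 2 ⊕ ℕ × Fin 2) :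
    Measurable (Sum.elim X₁ (fun q : ℕ × Fin 2 => W q.1 q.2) i) := by
  rcases i with i | q
  · exact hprim.measurable_init i
  · exact hprim.measurable_arrival q.1 q.2

lemma PrimitiveLaw.measurableSet_stateEvent (hprim : PrimitiveLaw P p X₁ W) (g : Strategy) (t : ℕ)
    (h : List Bits) (x : Bits) : MeasurableSet (stateEvent X₁ W g t h x) := by
  obtain ⟨S, -, A, hA⟩ := exists_stateEvent_eq X₁ W g t h x
  have hm : Measurable fun ω (i : S) => (Sum.elim X₁ (fun q : ℕ × Fin 2 => W q.1 q.2)) i ω :=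
    measurable_pi_lambda _ fun i => hprim.measurable i
  rw [hA]
  exact hm A.toFinite.measurableSet

lemma PrimitiveLaw.measurableSet_bufferState (hprim : PrimitiveLaw P p X₁ W) (g : Strategy)
    (t : ℕ) (x : Bits) : MeasurableSet {ω | bufferState X₁ W g t ω = x} := by
  have : {ω | bufferState X₁ W g t ω = x} =
      ⋃ h ∈ histories t, stateEvent X₁ W g t h x := by
    ext ω
    simp [stateEvent, history_mem]
  rw [this]
  exact Finset.measurableSet_biUnion _ fun h _ => hprim.measurableSet_stateEvent g t h x

lemma PrimitiveLaw.measurableSet_history (hprim : PrimitiveLaw P p X₁ W) (g : Strategy)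
    (t : ℕ) (h : List Bits) : MeasurableSet {ω | history X₁ W g t ω = h} := by
  have : {ω | history X₁ W g t ω = h} = ⋃ x, stateEvent X₁ W g t h x := by
    ext ω
    simp [stateEvent]
  rw [this]
  exact MeasurableSet.iUnion fun x => hprim.measurableSet_stateEvent g t h x

variable [IsProbabilityMeasure P]

lemma measureReal_eq_sum_fibers {ι : Type*} [Fintype ι] {Z : Ω → ι}
    (hZ : ∀ z, MeasurableSet {ω | Z ω = z}) (A : Set Ω) :
    P.real A = ∑ z, P.real (A ∩ {ω | Z ω = z}) := by
  have h := sum_measureReal_preimage_singleton (μ := P.restrict A) Finset.univ (f := Z)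
    fun z _ => hZ z
  rw [Finset.coe_univ, Set.preimage_univ, measureReal_restrict_apply_univ] at h
  rw [← h]
  refine Finset.sum_congr rfl fun z _ => ?_
  rw [Set.inter_comm]
  exact measureReal_restrict_apply (hZ z)

lemma measurableSet_bits_eq {Y : Fin 2 → Ω → Bool} (hm : ∀ i, Measurable (Y i)) (x : Bits) :
    MeasurableSet {ω | (fun i => Y i ω) = x} :=
  (measurable_pi_lambda (fun ω i => Y i ω) hm) (measurableSet_singleton x)

lemma measureReal_bits_eq {Y : Fin 2 → Ω → Bool} (hm : ∀ i, Measurable (Y i))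
    (hY : ∀ i, P.real {ω | Y i ω = true} = p i) (hind : iIndepFun Y P) (x : Bits) :
    P.real {ω | (fun i => Y i ω) = x} = stateProb p x := by
  have h1 := (iIndepFun_iff_measure_inter_preimage_eq_mul.1 hind) Finset.univ
    (sets := fun i => {x i}) fun i _ => measurableSet_singleton _
  have h2 : {ω | (fun i => Y i ω) = x} = ⋂ i ∈ (Finset.univ : Finset (Fin 2)), Y i ⁻¹' {x i} := by
    ext ω
    simp [funext_iff]
  rw [h2, measureReal_def, h1, ENNReal.toReal_prod, stateProb]
  refine Finset.prod_congr rfl fun i _ => ?_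
  rw [← measureReal_def]
  cases hx : x i
  · have h3 : Y i ⁻¹' {false} = {ω | Y i ω = true}ᶜ := by
      ext ω
      simp
    have h4 : MeasurableSet {ω | Y i ω = true} := hm i (measurableSet_singleton true)
    rw [h3, probReal_compl_eq_one_sub h4, hY]
    simp
  · rw [if_pos rfl]
    exact hY i

lemma PrimitiveLaw.measureReal_stateEvent_inter (hprim : PrimitiveLaw P p X₁ W) (g : Strategy)
    (t : ℕ) (h : List Bits) (x w : Bits) :
    P.real (stateEvent X₁ W g t h x ∩ {ω | (fun i => W t i ω) = w}) =
      P.real (stateEvent X₁ W g t h x) * stateProb p w := by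
  have hinj : Function.Injective fun i : Fin 2 => (Sum.inr (t, i) : Fin 2 ⊕ ℕ × Fin 2) := by
    intro i j hij
    simpa using hij
  have hw : P.real {ω | (fun i => W t i ω) = w} = stateProb p w :=
    measureReal_bits_eq (hprim.measurable_arrival t) (hprim.prob_arrival t)
      (iIndepFun.precomp hinj hprim.indep :) w
  obtain ⟨S, hS, A, hA⟩ := exists_stateEvent_eq X₁ W g t h x
  let T : Finset (Fin 2 ⊕ ℕ × Fin 2) := Finset.univ.map ⟨_, hinj⟩
  have hST : Disjoint S T := by
    refine Finset.disjoint_right.2 fun i hi => ?_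
    obtain ⟨j, -, rfl⟩ := Finset.mem_map.1 hi
    exact hS j
  have hT (i : Fin 2) : Sum.inr (t, i) ∈ T := Finset.mem_map_of_mem _ (Finset.mem_univ i)
  have hB : {ω | (fun i => W t i ω) = w} = (fun ω (i : T) =>
      (Sum.elim X₁ (fun q : ℕ × Fin 2 => W q.1 q.2)) i ω) ⁻¹'
        {v | (fun i => v ⟨Sum.inr (t, i), hT i⟩) = w} := rfl
  have hind : P (stateEvent X₁ W g t h x ∩ {ω | (fun i => W t i ω) = w}) =
      P (stateEvent X₁ W g t h x) * P {ω | (fun i => W t i ω) = w} := by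
    rw [hA, hB]
    exact (hprim.indep.indepFun_finset S T hST hprim.measurable).measure_inter_preimage_eq_mul
      _ _ A.toFinite.measurableSet (Set.toFinite _).measurableSet
  rw [measureReal_def, hind, ENNReal.toReal_mul, ← measureReal_def, ← measureReal_def, hw]

lemma PrimitiveLaw.measureReal_history (hprim : PrimitiveLaw P p X₁ W) (g : Strategy)
    (t : ℕ) (h : List Bits) :
    P.real {ω | history X₁ W g t ω = h} = ∑ x, P.real (stateEvent X₁ W g t h x) :=
  measureReal_eq_sum_fibers (hprim.measurableSet_bufferState g t) _

lemma PrimitiveLaw.measureReal_stateEvent_succ (hprim : PrimitiveLaw P p X₁ W) {g : Strategy}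
    (hg : Feasible g) (t : ℕ) (u : Bits) (h : List Bits) (y : Bits) :
    P.real (stateEvent X₁ W g (t + 1) (u :: h) y) =
      ∑ x, ∑ w, if transmit (prescribed g h) x = u ∧ nextState x u w = y then
        P.real (stateEvent X₁ W g t h x) * stateProb p w else 0 := by
  rw [measureReal_eq_sum_fibers (hprim.measurableSet_bufferState g t)]
  refine Finset.sum_congr rfl fun x _ => ?_
  rw [measureReal_eq_sum_fibers (measurableSet_bits_eq (hprim.measurable_arrival t))]
  refine Finset.sum_congr rfl fun w _ => ?_
  have hH (ω : Ω) : history X₁ W g (t + 1) ω = decision X₁ W g t ω :: history X₁ W g t ω := rfl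
  have hX (ω : Ω) : bufferState X₁ W g (t + 1) ω =
    nextState (bufferState X₁ W g t ω) (decision X₁ W g t ω) (fun i => W t i ω) := rfl
  split_ifs with hc
  · rw [← hprim.measureReal_stateEvent_inter]
    congr 1
    ext ω
    simp only [stateEvent, Set.mem_inter_iff, Set.mem_ofPred_eq, hH, hX, decision_eq_transmit hg,
      List.cons.injEq]
    constructor
    · rintro ⟨⟨⟨⟨-, h1⟩, -⟩, h2⟩, h3⟩
      exact ⟨⟨h1, h2⟩, h3⟩
    · rintro ⟨⟨h1, h2⟩, h3⟩
      rw [h1, h2, h3, hc.1]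
      exact ⟨⟨⟨⟨rfl, rfl⟩, hc.2⟩, rfl⟩, rfl⟩
  · rw [← measureReal_empty (μ := P)]
    congr 1
    ext ω
    simp only [stateEvent, Set.mem_inter_iff, Set.mem_ofPred_eq, hH, hX, decision_eq_transmit hg,
      List.cons.injEq, Set.mem_empty_iff_false, iff_false]
    rintro ⟨⟨⟨⟨h0, h1⟩, h4⟩, h2⟩, h3⟩
    rw [h1, h2] at h0
    rw [h1, h2, h3, h0] at h4
    exact hc ⟨h0, h4⟩

/-- Given the common information, the buffer states are independent with parameters `belief`. -/
lemma PrimitiveLaw.measureReal_stateEvent (hprim : PrimitiveLaw P p X₁ W) {g : Strategy}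
    (hg : Feasible g) (t : ℕ) (h : List Bits) (x : Bits) :
    P.real (stateEvent X₁ W g t h x) =
      P.real {ω | history X₁ W g t ω = h} * stateProb (belief p g h) x := by
  induction t generalizing h x with
  | zero =>
    cases h with
    | nil =>
      have h1 : {ω | history X₁ W g 0 ω = []} = Set.univ := Set.eq_univ_of_forall fun ω => rfl
      have h2 : stateEvent X₁ W g 0 [] x = {ω | (fun i => X₁ i ω) = x} := by
        ext ω
        exact ⟨fun h => h.2, fun h => ⟨rfl, h⟩⟩
      rw [h1, h2, probReal_univ, one_mul]
      exact measureReal_bits_eq hprim.measurable_init hprim.prob_init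
        (iIndepFun.precomp (Sum.inl_injective (β := ℕ × Fin 2)) hprim.indep :) x
    | cons u h =>
      have h1 : {ω | history X₁ W g 0 ω = u :: h} = ∅ :=
        Set.eq_empty_of_forall_notMem fun ω hω => List.cons_ne_nil _ _ (Eq.symm hω)
      have h2 : stateEvent X₁ W g 0 (u :: h) x = ∅ :=
        Set.eq_empty_of_forall_notMem fun ω hω => List.cons_ne_nil _ _ hω.1.symm
      rw [h1, h2, measureReal_empty, zero_mul]
  | succ t ih =>
    cases h with
    | nil =>
      have h1 : {ω | history X₁ W g (t + 1) ω = []} = ∅ :=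
        Set.eq_empty_of_forall_notMem fun ω hω => List.cons_ne_nil _ _ hω
      have h2 : stateEvent X₁ W g (t + 1) [] x = ∅ :=
        Set.eq_empty_of_forall_notMem fun ω hω => List.cons_ne_nil _ _ hω.1
      rw [h1, h2, measureReal_empty, zero_mul]
    | cons u h =>
      -- The weight factors into a term free of `y` and the updated product law; summing over `y`
      -- identifies the former as the probability of the history.
      have key (y : Bits) : P.real (stateEvent X₁ W g (t + 1) (u :: h) y) =
          P.real {ω | history X₁ W g t ω = h} *
            (∑ x, if transmit (prescribed g h) x = u then stateProb (belief p g h) x else 0) *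
              stateProb (belief p g (u :: h)) y := by
        rw [hprim.measureReal_stateEvent_succ hg, belief, mul_assoc, ← step_stateProb,
          Finset.mul_sum]
        refine Finset.sum_congr rfl fun x _ => ?_
        rw [Finset.mul_sum]
        refine Finset.sum_congr rfl fun w _ => ?_
        rw [mul_ite, mul_zero, ih, mul_assoc]
      rw [key, hprim.measureReal_history g (t + 1), Finset.sum_congr rfl fun y _ => key y,
        ← Finset.mul_sum,
        sum_stateProb, mul_one]

lemma PrimitiveLaw.cond_bufferState (hprim : PrimitiveLaw P p X₁ W) {g : Strategy}
    (hg : Feasible g) (t : ℕ) {h : List Bits} (hpos : P {ω | history X₁ W g t ω = h} ≠ 0)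
    (i : Fin 2) :
    (P[|{ω | history X₁ W g t ω = h}]).real {ω | bufferState X₁ W g t ω i = true} =
      belief p g h i := by
  have hm := hprim.measurableSet_history g t h
  have hne : P.real {ω | history X₁ W g t ω = h} ≠ 0 :=
    (ENNReal.toReal_pos hpos (measure_ne_top _ _)).ne'
  have hsum : P.real ({ω | history X₁ W g t ω = h} ∩ {ω | bufferState X₁ W g t ω i = true}) =
      ∑ x : Bits, if x i = true then P.real (stateEvent X₁ W g t h x) else 0 := by
    rw [measureReal_eq_sum_fibers (hprim.measurableSet_bufferState g t)]
    refine Finset.sum_congr rfl fun x _ => ?_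
    split_ifs with hx
    · congr 1
      ext ω
      constructor
      · rintro ⟨⟨h1, -⟩, h2⟩
        exact ⟨h1, h2⟩
      · rintro ⟨h1, h2⟩
        exact ⟨⟨h1, (congrFun h2 i).trans hx⟩, h2⟩
    · rw [← measureReal_empty (μ := P)]
      congr 1
      refine Set.eq_empty_of_forall_notMem ?_
      rintro ω ⟨⟨-, h1⟩, h2⟩
      exact hx ((congrFun h2 i).symm.trans h1)
  rw [measureReal_def, cond_apply hm, ENNReal.toReal_mul, ENNReal.toReal_inv, ← measureReal_def,
    ← measureReal_def, hsum]
  simp only [hprim.measureReal_stateEvent hg, ← mul_ite_zero, ← Finset.mul_sum]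
  rw [inv_mul_cancel_left₀ hne]
  simp only [sum_bits, stateProb, Fin.prod_univ_two]
  fin_cases i <;> simp <;> ring

end Probability

/-! ### Verification: comparing the value function with the total cost -/

lemma le_of_hasSum_of_le_add_mul {Φ c : ℕ → ℝ} {β C J : ℝ} (hβ : β ∈ Set.Ioo (0 : ℝ) 1)
    (hC : ∀ t, |Φ t| ≤ C) (h : ∀ t, Φ t ≤ c t + β * Φ (t + 1))
    (hJ : HasSum (fun t => β ^ t * c t) J) : Φ 0 ≤ J := by
  have key (n : ℕ) : Φ 0 ≤ ∑ t ∈ Finset.range n, β ^ t * c t + β ^ n * Φ n := by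
    induction n with
    | zero => simp
    | succ n ih =>
      have := mul_le_mul_of_nonneg_left (h n) (pow_nonneg hβ.1.le n)
      rw [Finset.sum_range_succ, pow_succ]
      linarith
  have hlim : Filter.Tendsto (fun n => β ^ n * Φ n) Filter.atTop (nhds 0) := by
    refine squeeze_zero_norm (a := fun n => β ^ n * C) (fun n => ?_) ?_
    · rw [norm_mul, norm_pow, Real.norm_eq_abs, Real.norm_eq_abs, abs_of_pos hβ.1]
      exact mul_le_mul_of_nonneg_left (hC n) (pow_nonneg hβ.1.le n)
    · simpa using (tendsto_pow_atTop_nhds_zero_of_lt_one hβ.1.le hβ.2).mul_const C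
  have := hJ.tendsto_sum_nat.add hlim
  rw [add_zero] at this
  exact ge_of_tendsto' this key

section Probability

variable {Ω : Type*} {X₁ : Fin 2 → Ω → Bool} {W : ℕ → Fin 2 → Ω → Bool}

lemma eq_sum_indicator (g : Strategy) (t : ℕ) (F : List Bits → Bits → ℝ) (ω : Ω) :
    F (history X₁ W g t ω) (bufferState X₁ W g t ω) = ∑ q ∈ histories t ×ˢ Finset.univ,
      (stateEvent X₁ W g t q.1 q.2).indicator (fun _ => F q.1 q.2) ω := by
  rw [Finset.sum_eq_single (history X₁ W g t ω, bufferState X₁ W g t ω)]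
  · exact (Set.indicator_of_mem (s := stateEvent X₁ W g t _ _) ⟨rfl, rfl⟩ fun _ => F _ _).symm
  · rintro ⟨h, x⟩ - hne
    refine Set.indicator_of_notMem (fun hmem => hne ?_) _
    exact Prod.ext hmem.1.symm hmem.2.symm
  · exact fun h => (h (Finset.mem_product.2 ⟨history_mem g t ω, Finset.mem_univ _⟩)).elim

variable [MeasurableSpace Ω] {P : Measure Ω} [IsProbabilityMeasure P] {p : Fin 2 → ℝ}

lemma PrimitiveLaw.integrable (hprim : PrimitiveLaw P p X₁ W) (g : Strategy) (t : ℕ)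
    (F : List Bits → Bits → ℝ) :
    Integrable (fun ω => F (history X₁ W g t ω) (bufferState X₁ W g t ω)) P := by
  simp only [eq_sum_indicator]
  exact integrable_finsetSum _ fun q _ =>
    (integrable_const _).indicator (hprim.measurableSet_stateEvent g t _ _)

/-- Only finitely many histories occur at each time, so conditioning on the common information is a
finite sum. -/
lemma PrimitiveLaw.integral_eq_sum (hprim : PrimitiveLaw P p X₁ W) {g : Strategy}
    (hg : Feasible g) (t : ℕ) (F : List Bits → Bits → ℝ) :
    ∫ ω, F (history X₁ W g t ω) (bufferState X₁ W g t ω) ∂P =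
      ∑ h ∈ histories t, P.real {ω | history X₁ W g t ω = h} *
        ∑ x, stateProb (belief p g h) x * F h x := by
  simp only [eq_sum_indicator]
  rw [integral_finsetSum _ fun q _ =>
    (integrable_const _).indicator (hprim.measurableSet_stateEvent g t _ _), Finset.sum_product]
  refine Finset.sum_congr rfl fun h _ => ?_
  rw [Finset.mul_sum]
  refine Finset.sum_congr rfl fun x _ => ?_
  rw [integral_indicator_const _ (hprim.measurableSet_stateEvent g t _ _),
    hprim.measureReal_stateEvent hg, smul_eq_mul, mul_assoc]

lemma PrimitiveLaw.integral_value (hprim : PrimitiveLaw P p X₁ W) {g : Strategy}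
    (hg : Feasible g) (V : (Fin 2 → ℝ) → ℝ) (t : ℕ) :
    ∫ ω, V (belief p g (history X₁ W g t ω)) ∂P =
      ∑ h ∈ histories t, P.real {ω | history X₁ W g t ω = h} * V (belief p g h) := by
  rw [hprim.integral_eq_sum hg t fun h _ => V (belief p g h)]
  simp only [← Finset.sum_mul, sum_stateProb, one_mul]

lemma PrimitiveLaw.integral_value_succ (hprim : PrimitiveLaw P p X₁ W) {g : Strategy}
    (hg : Feasible g) (V : (Fin 2 → ℝ) → ℝ) (t : ℕ) :
    ∫ ω, V (belief p g (history X₁ W g (t + 1) ω)) ∂P =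
      ∑ h ∈ histories t, P.real {ω | history X₁ W g t ω = h} *
        expectedNext p V (belief p g h) (prescribed g h) := by
  have hH (ω : Ω) : history X₁ W g (t + 1) ω = decision X₁ W g t ω :: history X₁ W g t ω := rfl
  simp only [hH, belief, decision_eq_transmit hg]
  exact hprim.integral_eq_sum hg t fun h x =>
    V (update p (belief p g h) (prescribed g h) (transmit (prescribed g h) x))

lemma PrimitiveLaw.integral_stageCost (hprim : PrimitiveLaw P p X₁ W) {g : Strategy}
    (hg : Feasible g) (l1 l2 l3 : ℝ) (t : ℕ) :
    ∫ ω, stageCost l1 l2 l3 (decision X₁ W g t ω) ∂P =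
      ∑ h ∈ histories t, P.real {ω | history X₁ W g t ω = h} *
        expectedCost l1 l2 l3 (belief p g h) (prescribed g h) := by
  simp only [decision_eq_transmit hg, ← sum_stateProb_mul_stageCost]
  exact hprim.integral_eq_sum hg t fun h x => stageCost l1 l2 l3 (transmit (prescribed g h) x)

lemma PrimitiveLaw.integral_cost_add (hprim : PrimitiveLaw P p X₁ W) {g : Strategy}
    (hg : Feasible g) (β l1 l2 l3 : ℝ) (V : (Fin 2 → ℝ) → ℝ) (t : ℕ) :
    ∫ ω, stageCost l1 l2 l3 (decision X₁ W g t ω) ∂P +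
        β * ∫ ω, V (belief p g (history X₁ W g (t + 1) ω)) ∂P =
      ∑ h ∈ histories t, P.real {ω | history X₁ W g t ω = h} *
        bellmanRHS p β l1 l2 l3 V (belief p g h) (prescribed g h) := by
  rw [hprim.integral_stageCost hg, hprim.integral_value_succ hg, Finset.mul_sum,
    ← Finset.sum_add_distrib]
  refine Finset.sum_congr rfl fun h _ => ?_
  rw [bellmanRHS]
  ring

/-- The stage cost is bounded, so a geometric series justifies exchanging sum and integral. -/
lemma PrimitiveLaw.hasSum_totalCost (hprim : PrimitiveLaw P p X₁ W) {g : Strategy}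
    (hg : Feasible g) {β : ℝ} (hβ : β ∈ Set.Ioo (0 : ℝ) 1) (l1 l2 l3 : ℝ) :
    HasSum (fun t => β ^ t * ∫ ω, stageCost l1 l2 l3 (decision X₁ W g t ω) ∂P)
      (totalCost P X₁ W β l1 l2 l3 g) := by
  have hint (t : ℕ) : Integrable (fun ω => stageCost l1 l2 l3 (decision X₁ W g t ω)) P := by
    simp only [decision_eq_transmit hg]
    exact hprim.integrable g t fun h x => stageCost l1 l2 l3 (transmit (prescribed g h) x)
  have h := hasSum_integral_of_summable_integral_norm
    (F := fun t ω => β ^ t * stageCost l1 l2 l3 (decision X₁ W g t ω))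
    (fun t => (hint t).const_mul _) (Summable.of_nonneg_of_le
      (fun t => integral_nonneg fun ω => norm_nonneg _) (fun t => ?_)
      ((summable_geometric_of_lt_one hβ.1.le hβ.2).mul_right (|l1| + |l2| + |l3|)))
  · simp only [integral_const_mul] at h
    exact h
  · calc _ ≤ ∫ _, β ^ t * (|l1| + |l2| + |l3|) ∂P := by
          refine integral_mono ((hint t).const_mul _).norm (integrable_const _) fun ω => ?_
          rw [norm_mul, norm_pow, Real.norm_eq_abs, Real.norm_eq_abs, abs_of_pos hβ.1]
          exact mul_le_mul_of_nonneg_left (abs_stageCost_le _ _ _ _) (pow_nonneg hβ.1.le t)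
      _ = β ^ t * (|l1| + |l2| + |l3|) := by simp

lemma abs_integral_value_le (hp : p ∈ box) {V : (Fin 2 → ℝ) → ℝ} {C : ℝ}
    (hC : ∀ π ∈ box, |V π| ≤ C) (g : Strategy) (t : ℕ) :
    |∫ ω, V (belief p g (history X₁ W g t ω)) ∂P| ≤ C := by
  have := norm_integral_le_of_norm_le_const (μ := P) (C := C)
    (f := fun ω => V (belief p g (history X₁ W g t ω)))
    (Filter.Eventually.of_forall fun ω => hC _ (belief_mem_box hp g _))
  simpa using this

lemma integral_value_zero (V : (Fin 2 → ℝ) → ℝ) (g : Strategy) :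
    ∫ ω, V (belief p g (history X₁ W g 0 ω)) ∂P = V p := by
  have h (ω : Ω) : history X₁ W g 0 ω = [] := rfl
  simp [h, belief]

lemma PrimitiveLaw.value_le_totalCost (hprim : PrimitiveLaw P p X₁ W) (hp : p ∈ box)
    {g : Strategy} (hg : Feasible g) {β : ℝ} (hβ : β ∈ Set.Ioo (0 : ℝ) 1) {l1 l2 l3 : ℝ}
    {V : (Fin 2 → ℝ) → ℝ} {C : ℝ} (hC : ∀ π ∈ box, |V π| ≤ C)
    (hV : ∀ h, V (belief p g h) ≤ bellmanRHS p β l1 l2 l3 V (belief p g h) (prescribed g h)) :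
    V p ≤ totalCost P X₁ W β l1 l2 l3 g := by
  rw [← integral_value_zero (P := P) (X₁ := X₁) (W := W) V g]
  refine le_of_hasSum_of_le_add_mul hβ (abs_integral_value_le hp hC g) (fun t => ?_)
    (hprim.hasSum_totalCost hg hβ l1 l2 l3)
  rw [hprim.integral_cost_add hg, hprim.integral_value hg]
  exact Finset.sum_le_sum fun h _ => mul_le_mul_of_nonneg_left (hV h) measureReal_nonneg

lemma PrimitiveLaw.totalCost_le_value (hprim : PrimitiveLaw P p X₁ W) (hp : p ∈ box)
    {g : Strategy} (hg : Feasible g) {β : ℝ} (hβ : β ∈ Set.Ioo (0 : ℝ) 1) {l1 l2 l3 : ℝ}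
    {V : (Fin 2 → ℝ) → ℝ} {C : ℝ} (hC : ∀ π ∈ box, |V π| ≤ C)
    (hV : ∀ h, bellmanRHS p β l1 l2 l3 V (belief p g h) (prescribed g h) ≤ V (belief p g h)) :
    totalCost P X₁ W β l1 l2 l3 g ≤ V p := by
  rw [← integral_value_zero (P := P) (X₁ := X₁) (W := W) V g, ← neg_le_neg_iff]
  refine le_of_hasSum_of_le_add_mul (C := C)
    (Φ := fun t => -∫ ω, V (belief p g (history X₁ W g t ω)) ∂P)
    (c := fun t => -∫ ω, stageCost l1 l2 l3 (decision X₁ W g t ω) ∂P) hβ (fun t => ?_)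
    (fun t => ?_) ?_
  · rw [abs_neg]
    exact abs_integral_value_le hp hC g t
  · rw [mul_neg, ← neg_add, neg_le_neg_iff, hprim.integral_cost_add hg, hprim.integral_value hg]
    exact Finset.sum_le_sum fun h _ => mul_le_mul_of_nonneg_left (hV h) measureReal_nonneg
  · simpa only [mul_neg] using (hprim.hasSum_totalCost hg hβ l1 l2 l3).neg

end Probability

/-! ### Optimality of the stationary strategy -/

lemma infoState_mem_reachableSet {p : Fin 2 → ℝ} {ψ : (Fin 2 → ℝ) → Bits}
    (hψ : ∀ π ∈ reachableSet p, ψ π ∈ actions) (h : List Bits) :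
    infoState p ψ h ∈ reachableSet p := by
  induction h with
  | nil => exact initial_mem_reachableSet p
  | cons u h ih => exact update_mem_reachableSet ih (hψ _ ih) u

end MABC
end

open MABC
theorem theorem4 {Ω : Type*} [MeasurableSpace Ω] (P : Measure Ω) [IsProbabilityMeasure P]
    (p : Fin 2 → ℝ) (hp : ∀ i, p i ∈ Set.Ioo (0 : ℝ) 1)
    (X₁ : Fin 2 → Ω → Bool) (W : ℕ → Fin 2 → Ω → Bool) (hprim : PrimitiveLaw P p X₁ W)
    (β : ℝ) (hβ : β ∈ Set.Ioo (0 : ℝ) 1)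
    (l1 l2 l3 : ℝ) (hl1 : l1 ≤ 0) (hl2 : l2 ≤ 0) :
    -- the dynamic program has a bounded solution, unique on the reachable set
    (∃ V, SolvesDP p β l1 l2 l3 V) ∧
    (∀ V V', SolvesDP p β l1 l2 l3 V → SolvesDP p β l1 l2 l3 V' →
      Set.EqOn V V' (reachableSet p)) ∧
    ∀ V ψ, SolvesDP p β l1 l2 l3 V → IsArgmin p β l1 l2 l3 V ψ →
      -- the information state stays in the reachable set and consists of the conditional
      -- probabilities of full buffers given the common information
      (∀ h, infoState p ψ h ∈ reachableSet p) ∧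
      (∀ t h, P {ω | history X₁ W (stationaryStrategy p ψ) t ω = h} ≠ 0 → ∀ i,
        (P[|{ω | history X₁ W (stationaryStrategy p ψ) t ω = h}]).real
            {ω | bufferState X₁ W (stationaryStrategy p ψ) t ω i = true} =
          infoState p ψ h i) ∧
      -- optimality among the strategies of the coordinator with the given action space
      IsOptimalIn (totalCost P X₁ W β l1 l2 l3)
        {g | Feasible g ∧ ∀ h, prescribed g h ∈ actions} (stationaryStrategy p ψ) ∧
      -- optimality among all feasible decentralized strategies, if collisions are not rewarded
      (0 ≤ l3 →
        IsOptimalIn (totalCost P X₁ W β l1 l2 l3) {g | Feasible g} (stationaryStrategy p ψ)) := by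
  have hbox : p ∈ box := fun i => ⟨(hp i).1.le, (hp i).2.le⟩
  have hR := reachableSet_subset_box hbox
  have huniq (V V' : (Fin 2 → ℝ) → ℝ) (h : SolvesDP p β l1 l2 l3 V)
      (h' : SolvesDP p β l1 l2 l3 V') : Set.EqOn V V' (reachableSet p) :=
    SolvesOn.eqOn hR (fun π hπ a ha u => update_mem_reachableSet hπ ha u) hβ h h'
  obtain ⟨V₀, hV₀⟩ := exists_solvesOn_box hbox hβ l1 l2 l3
  refine ⟨⟨V₀, hV₀.mono hR⟩, huniq, fun V ψ hV hψ => ?_⟩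
  have hact (h : List Bits) : infoState p ψ h ∈ reachableSet p :=
    infoState_mem_reachableSet (fun π hπ => (hψ π hπ).1) h
  have hfeas := feasible_stationaryStrategy p ψ
  have heq := huniq V V₀ hV (hV₀.mono hR)
  obtain ⟨C, hC⟩ := hV₀.1
  have hcost : totalCost P X₁ W β l1 l2 l3 (stationaryStrategy p ψ) ≤ V₀ p := by
    refine hprim.totalCost_le_value hbox hfeas hβ hC fun h => ?_
    rw [belief_stationaryStrategy, prescribed_stationaryStrategy]
    have hmem := hact h
    set π := infoState p ψ h
    -- `ψ` minimizes for `V`, not for `V₀`; the two right-hand sides agree because every successor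
    -- of a reachable state is reachable.
    have hcongr {a : Bits} (ha : a ∈ actions) := bellmanRHS_congr (π := π) β l1 l2 l3
      fun u => heq (update_mem_reachableSet hmem ha u)
    obtain ⟨a, ha, e⟩ := hV₀.exists_eq (hR hmem)
    rw [← e, ← hcongr (hψ π hmem).1, ← hcongr ha]
    exact (hψ π hmem).2 a ha
  refine ⟨hact, fun t h hpos i => ?_, ⟨⟨hfeas, fun h => ?_⟩, fun g hg => ?_⟩,
    fun hl3 => ⟨hfeas, fun g hg => ?_⟩⟩
  · rw [hprim.cond_bufferState hfeas t hpos, belief_stationaryStrategy]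
  · rw [prescribed_stationaryStrategy]
    exact (hψ _ (hact h)).1
  · exact hcost.trans (hprim.value_le_totalCost hbox hg.1 hβ hC fun h =>
      hV₀.le (belief_mem_box hbox g h) (hg.2 h))
  · refine hcost.trans (hprim.value_le_totalCost hbox hg hβ hC fun h => ?_)
    have hmem := belief_mem_box hbox g h
    rcases bits_cases (prescribed g h) with ha | ha | ha | ha <;> rw [ha]
    · exact hV₀.le_idle hbox hβ hl1 hl2 hl3 hmem
    all_goals exact hV₀.le hmem (by simp [actions])
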